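/- For complex $a,q$ with $|a|<1$ and $|q|<1$ let $$u(a,q)=\cfrac{2a}{1-q+\cfrac{a^2(1+q)^2}{1-q^3+\cfrac{a^2q(1+q^2)^2}{1-q^5+\cfrac{a^2q^2(1+q^3)^2}{1-q^7+\cdots}}}}$$ be the value of the continued fraction, i.e. the limit of its convergents in the Riemann sphere $\mathbb C\cup\{\infty\}$. Then this limit exists, $u(a,q)\neq 1$, the series below converges absolutely, and $$4\sum_{n=0}^{\infty}\frac{a^{2n+1}}{(2n+1)(1-q^{2n+1})}=\log\left(-1+\frac{2}{1-u(a,q)}\right),$$ where the argument of the logarithm is read as $-1$ if $u(a,q)=\infty$, and where, for each fixed $q$, $\log$ denotes the unique branch of the logarithm of $-1+\frac{2}{1-u(a,q)}$ that is continuous in $a$ on the disc $|a|<1$ and vanishes at $a=0$. In particular, $\log$ is the principal logarithm whenever the imaginary part of the left-hand side lies in $(-\pi,\pi]$; and for real $a,q\in(-1,1)$ the number $u(a,q)$ is real with $|u(a,q)|<1$ and $\log$ is the ordinary real logarithm. -/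

import Mathlib

open Filter Topology

namespace RamanujanCF

/-- The continued fraction
`2a / (1 - q + a²(1 + q)² / (1 - q³ + a²q(1 + q²)² / (1 - q⁵ + a²q²(1 + q³)² / (1 - q⁷ + ⋯))))`. -/
def cf (a q : ℂ) : GenContFract ℂ where
  h := 0
  s := Stream'.Seq.ofStream fun n : ℕ =>
    { a := match n with
        | 0 => 2 * a
        | m + 1 => a ^ 2 * q ^ m * (1 + q ^ (m + 1)) ^ 2
      b := 1 - q ^ (2 * n + 1) }

/-- The `n`-th convergent `Aₙ / Bₙ` of a continued fraction, as a point of the Riemann sphere: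
it is `∞` when `Bₙ = 0`. -/
noncomputable def convergent (g : GenContFract ℂ) (n : ℕ) : OnePoint ℂ :=
  open Classical in
  if g.dens n = 0 then OnePoint.infty else ((g.convs n : ℂ) : OnePoint ℂ)

/-- The value `u(a, q)` of the continued fraction: the limit of its convergents in the Riemann
sphere. -/
noncomputable def u (a q : ℂ) : OnePoint ℂ :=
  limUnder atTop (convergent (cf a q))

/-- The Möbius map `w ↦ -1 + 2 / (1 - w)` on the Riemann sphere without the point `1`; it sends
`∞` to `-1`. (The value at `w = 1` is a placeholder.) -/
noncomputable def moebius (w : OnePoint ℂ) : ℂ :=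
  w.elim (-1) fun z => -1 + 2 / (1 - z)

/-- The term `a^(2n+1) / ((2n+1)(1 - q^(2n+1)))` of the Lambert-type series. -/
noncomputable def term (a q : ℂ) (n : ℕ) : ℂ :=
  a ^ (2 * n + 1) / ((2 * (n : ℂ) + 1) * (1 - q ^ (2 * n + 1)))

/-- `ℓ` is a branch of `log F` on the open unit disc: it is continuous there, `exp ∘ ℓ = F`, and it
is normalized by `ℓ 0 = 0`. -/
def IsLogBranch (ℓ F : ℂ → ℂ) : Prop :=
  ContinuousOn ℓ (Metric.ball 0 1) ∧ ℓ 0 = 0 ∧ ∀ a ∈ Metric.ball (0 : ℂ) 1, Complex.exp (ℓ a) = F a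

end RamanujanCF

namespace RamanujanCF

/-! Both sides are governed by F(z) = ∑ (-1; q)_k / (q; q)_k z^k, which satisfies (1 - z) F(z) = (1
+ z) F(qz) and has no zero in the disc. An explicit solution T_n = `tail a q n` of the backward
recurrence splits F by parity: T_0 ± 2a T_1 = F(±a). Pairing T_n with the numerators and
denominators gives A_n T_n → 2a T_1 and B_n T_n → T_0 (`tendsto_mul_tail`). Hence u = 2a T_1 / T_0
on the sphere, and `moebius` sends it to F(a) / F(-a). The exponential of the series obeys the same
functional equation under a ↦ qa as this quotient, and both tend to 1 along q^n a, so they agree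
(`exp_tsum_term`). Continuity of the series then identifies the branch. -/

/-! ### Uniform bounds for finite q-products -/

lemma norm_prod_one_add_le {r : ℝ} (hr0 : 0 ≤ r) (hr1 : r < 1) {f : ℕ → ℂ}
    (hf : ∀ i, ‖f i‖ ≤ r ^ i) (k : ℕ) :
    ‖∏ i ∈ Finset.range k, (1 + f i)‖ ≤ Real.exp (1 - r)⁻¹ := by
  calc ‖∏ i ∈ Finset.range k, (1 + f i)‖
      ≤ ∏ i ∈ Finset.range k, Real.exp (r ^ i) := by
        rw [norm_prod]
        refine Finset.prod_le_prod (fun _ _ => norm_nonneg _) fun i _ => ?_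
        have h1 := norm_add_le (1 : ℂ) (f i)
        have h2 := Real.add_one_le_exp (r ^ i)
        have h3 := hf i
        rw [norm_one] at h1
        linarith
    _ = Real.exp (∑ i ∈ Finset.range k, r ^ i) := (Real.exp_sum _ _).symm
    _ ≤ Real.exp (1 - r)⁻¹ := by
        rw [Real.exp_le_exp, ← tsum_geometric_of_lt_one hr0 hr1]
        exact (summable_geometric_of_lt_one hr0 hr1).sum_le_tsum _ fun _ _ => pow_nonneg hr0 _

lemma one_sub_ne_zero_of_norm_lt_one {z : ℂ} (hz : ‖z‖ < 1) : 1 - z ≠ 0 := by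
  intro h
  rw [← sub_eq_zero.mp h, norm_one] at hz
  exact lt_irrefl _ hz

lemma one_add_ne_zero_of_norm_lt_one {z : ℂ} (hz : ‖z‖ < 1) : 1 + z ≠ 0 := by
  simpa using one_sub_ne_zero_of_norm_lt_one (z := -z) (by simpa using hz)

/-- For x = ‖f i‖, 1/(1 - x) = 1 + x/(1 - x) ≤ 1 + r^i/(1 - r), and the geometric series sums the
exponents. -/
lemma norm_prod_one_sub_inv_le {r : ℝ} (hr0 : 0 ≤ r) (hr1 : r < 1) {f : ℕ → ℂ}
    (hf : ∀ i, ‖f i‖ ≤ r ^ (i + 1)) (k : ℕ) :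
    ‖(∏ i ∈ Finset.range k, (1 - f i))⁻¹‖ ≤ Real.exp ((1 - r)⁻¹ * (1 - r)⁻¹) := by
  have h1r : 0 < 1 - r := by linarith
  calc ‖(∏ i ∈ Finset.range k, (1 - f i))⁻¹‖
      ≤ ∏ i ∈ Finset.range k, Real.exp (r ^ i * (1 - r)⁻¹) := by
        rw [norm_inv, norm_prod, ← Finset.prod_inv_distrib]
        refine Finset.prod_le_prod (fun _ _ => inv_nonneg.mpr (norm_nonneg _)) fun i _ => ?_
        have h1 := norm_sub_norm_le (1 : ℂ) (f i)
        have h2 := Real.add_one_le_exp (r ^ i * (1 - r)⁻¹)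
        have h3 := hf i
        rw [norm_one] at h1
        have h4 : r ^ (i + 1) ≤ r := by
          simpa using pow_le_pow_of_le_one hr0 hr1.le (Nat.succ_le_succ (Nat.zero_le i))
        have h5 : r ^ (i + 1) ≤ r ^ i := pow_le_pow_of_le_one hr0 hr1.le (Nat.le_succ i)
        have h6 : 0 ≤ r ^ i := pow_nonneg hr0 i
        refine le_trans ?_ h2
        have h7 : 0 < 1 - ‖f i‖ := by linarith
        refine (inv_anti₀ h7 h1).trans ?_
        rw [inv_le_iff_one_le_mul₀ h7]
        have h8 : 1 ≤ (1 - ‖f i‖) * (1 - r)⁻¹ := by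
          rw [← div_eq_mul_inv, one_le_div h1r]; linarith
        nlinarith [norm_nonneg (f i)]
    _ = Real.exp (∑ i ∈ Finset.range k, r ^ i * (1 - r)⁻¹) := (Real.exp_sum _ _).symm
    _ ≤ Real.exp ((1 - r)⁻¹ * (1 - r)⁻¹) := by
        rw [Real.exp_le_exp, ← Finset.sum_mul]
        refine mul_le_mul_of_nonneg_right ?_ (inv_nonneg.mpr h1r.le)
        rw [← tsum_geometric_of_lt_one hr0 hr1]
        exact (summable_geometric_of_lt_one hr0 hr1).sum_le_tsum _ fun _ _ => pow_nonneg hr0 _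

/-! ### Power series with bounded coefficients, with exponents k, 2k or 2k + 1 -/

section BoundedCoefficients

variable {c : ℕ → ℂ} {C : ℝ} {e : ℕ → ℕ}

lemma norm_mul_pow_le (hc : ∀ k, ‖c k‖ ≤ C) (he : ∀ k, k ≤ e k) {z : ℂ} {ρ : ℝ} (hz : ‖z‖ ≤ ρ)
    (hρ : ρ ≤ 1) (k : ℕ) : ‖c k * z ^ e k‖ ≤ C * ρ ^ k := by
  have h0 : 0 ≤ ρ := (norm_nonneg z).trans hz
  rw [norm_mul, norm_pow]
  refine mul_le_mul (hc k) ?_ (by positivity) ((norm_nonneg _).trans (hc k))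
  exact (pow_le_pow_left₀ (norm_nonneg _) hz _).trans (pow_le_pow_of_le_one h0 hρ (he k))

lemma summable_mul_pow (hc : ∀ k, ‖c k‖ ≤ C) (he : ∀ k, k ≤ e k) {z : ℂ} (hz : ‖z‖ < 1) :
    Summable fun k => c k * z ^ e k :=
  .of_norm_bounded ((summable_geometric_of_lt_one (norm_nonneg z) hz).mul_left C)
    (norm_mul_pow_le hc he le_rfl hz.le)

lemma continuousOn_tsum_mul_pow (hc : ∀ k, ‖c k‖ ≤ C) (he : ∀ k, k ≤ e k) :
    ContinuousOn (fun z => ∑' k, c k * z ^ e k) (Metric.ball 0 1) := by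
  intro z hz
  rw [mem_ball_zero_iff] at hz
  obtain ⟨ρ, hρ, hρ1⟩ := exists_between hz
  have h : ContinuousOn (fun z => ∑' k, c k * z ^ e k) (Metric.closedBall 0 ρ) :=
    continuousOn_tsum (fun k => by fun_prop)
      ((summable_geometric_of_lt_one ((norm_nonneg z).trans hρ.le) hρ1).mul_left C)
      fun k w hw => norm_mul_pow_le hc he (mem_closedBall_zero_iff.mp hw) hρ1.le k
  refine (h.continuousAt ?_).continuousWithinAt
  exact mem_of_superset (Metric.isOpen_ball.mem_nhds (mem_ball_zero_iff.mpr hρ))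
    Metric.ball_subset_closedBall

end BoundedCoefficients

/-! ### The q-binomial series -/

/-- The coefficient `(c; q)_k / (q; q)_k` of the `q`-binomial series. -/
noncomputable def qBinomCoeff (c q : ℂ) (k : ℕ) : ℂ :=
  (∏ i ∈ Finset.range k, (1 - c * q ^ i)) / ∏ i ∈ Finset.range k, (1 - q ^ (i + 1))

/-- The `q`-binomial series `∑ (c; q)_k / (q; q)_k z ^ k`. -/
noncomputable def qBinomSeries (c q z : ℂ) : ℂ := ∑' k, qBinomCoeff c q k * z ^ k

lemma one_sub_pow_ne_zero {q : ℂ} (hq : ‖q‖ < 1) {n : ℕ} (hn : n ≠ 0) : 1 - q ^ n ≠ 0 :=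
  one_sub_ne_zero_of_norm_lt_one (by rw [norm_pow]; exact pow_lt_one₀ (norm_nonneg _) hq hn)

lemma exists_norm_qBinomCoeff_le {c q : ℂ} (hc : ‖c‖ ≤ 1) (hq : ‖q‖ < 1) :
    ∃ C, ∀ k, ‖qBinomCoeff c q k‖ ≤ C := by
  refine ⟨Real.exp (1 - ‖q‖)⁻¹ * Real.exp ((1 - ‖q‖)⁻¹ * (1 - ‖q‖)⁻¹), fun k => ?_⟩
  rw [qBinomCoeff, div_eq_mul_inv, norm_mul]
  refine mul_le_mul ?_ (norm_prod_one_sub_inv_le (norm_nonneg q) hq (fun i => (norm_pow _ _).le) k)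
    (norm_nonneg _) (Real.exp_pos _).le
  simp only [sub_eq_add_neg]
  refine norm_prod_one_add_le (norm_nonneg q) hq (fun i => ?_) k
  rw [norm_neg, norm_mul, norm_pow]
  exact mul_le_of_le_one_left (by positivity) hc

lemma qBinomCoeff_succ {q : ℂ} (c : ℂ) (hq : ‖q‖ < 1) (k : ℕ) :
    qBinomCoeff c q (k + 1) * (1 - q ^ (k + 1)) = qBinomCoeff c q k * (1 - c * q ^ k) := by
  have h := one_sub_pow_ne_zero hq k.succ_ne_zero
  have h' : ∏ i ∈ Finset.range k, (1 - q ^ (i + 1)) ≠ 0 :=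
    Finset.prod_ne_zero_iff.mpr fun i _ => one_sub_pow_ne_zero hq i.succ_ne_zero
  simp only [qBinomCoeff, Finset.prod_range_succ]
  field_simp

lemma summable_qBinomSeries {c q z : ℂ} (hc : ‖c‖ ≤ 1) (hq : ‖q‖ < 1) (hz : ‖z‖ < 1) :
    Summable fun k => qBinomCoeff c q k * z ^ k := by
  obtain ⟨C, hC⟩ := exists_norm_qBinomCoeff_le hc hq
  exact summable_mul_pow hC (fun k => le_rfl) hz

lemma norm_mul_lt_one {q z : ℂ} (hq : ‖q‖ < 1) (hz : ‖z‖ < 1) : ‖q * z‖ < 1 := by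
  rw [norm_mul]; exact mul_lt_one_of_nonneg_of_lt_one_left (norm_nonneg _) hq hz.le

/-- Comparing coefficients of z^(k+1) leaves exactly `qBinomCoeff_succ`. This equation replaces the
infinite product formula throughout. -/
lemma qBinomSeries_functional_eq {c q z : ℂ} (hc : ‖c‖ ≤ 1) (hq : ‖q‖ < 1) (hz : ‖z‖ < 1) :
    (1 - z) * qBinomSeries c q z = (1 - c * z) * qBinomSeries c q (q * z) := by
  have h1 := summable_qBinomSeries hc hq hz
  have h2 := summable_qBinomSeries hc hq (norm_mul_lt_one hq hz)
  have h3 : qBinomSeries c q z - qBinomSeries c q (q * z) =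
      z * qBinomSeries c q z - c * z * qBinomSeries c q (q * z) := by
    unfold qBinomSeries
    rw [← tsum_mul_left, ← tsum_mul_left, ← h1.tsum_sub h2,
      ← (h1.mul_left z).tsum_sub (h2.mul_left (c * z)), (h1.sub h2).tsum_eq_zero_add]
    simp only [pow_zero, sub_self, zero_add]
    refine tsum_congr fun k => ?_
    linear_combination z ^ (k + 1) * qBinomCoeff_succ c hq k
  linear_combination h3

lemma qBinomSeries_zero (c q : ℂ) : qBinomSeries c q 0 = 1 := by
  rw [qBinomSeries, tsum_eq_single 0 (by intro k hk; simp [hk])]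
  simp [qBinomCoeff]

lemma tendsto_pow_mul_nhds_zero {q : ℂ} (hq : ‖q‖ < 1) (z : ℂ) :
    Tendsto (fun n : ℕ => q ^ n * z) atTop (𝓝 0) := by
  simpa using (tendsto_pow_atTop_nhds_zero_of_norm_lt_one hq).mul_const z

lemma tendsto_qBinomSeries {c q : ℂ} (hc : ‖c‖ ≤ 1) (hq : ‖q‖ < 1) (z : ℂ) :
    Tendsto (fun n : ℕ => qBinomSeries c q (q ^ n * z)) atTop (𝓝 1) := by
  obtain ⟨C, hC⟩ := exists_norm_qBinomCoeff_le hc hq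
  have h := (continuousOn_tsum_mul_pow hC (fun k => le_rfl)).continuousAt
    (Metric.ball_mem_nhds 0 one_pos)
  have h' : Tendsto (qBinomSeries c q) (𝓝 0) (𝓝 1) := by
    rw [← qBinomSeries_zero c q]; exact h
  exact h'.comp (tendsto_pow_mul_nhds_zero hq z)

lemma norm_pow_mul_lt_one {q z : ℂ} (hq : ‖q‖ < 1) (hz : ‖z‖ < 1) (n : ℕ) : ‖q ^ n * z‖ < 1 := by
  rw [norm_mul, norm_pow]
  exact (mul_le_of_le_one_left (norm_nonneg _) (pow_le_one₀ (norm_nonneg _) hq.le)).trans_lt hz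

/-- By the functional equation a zero at z would propagate to every q^n z, where the values tend to
1. -/
lemma qBinomSeries_ne_zero {c q z : ℂ} (hc : ‖c‖ ≤ 1) (hq : ‖q‖ < 1) (hz : ‖z‖ < 1) :
    qBinomSeries c q z ≠ 0 := by
  obtain ⟨n, hn⟩ := ((tendsto_qBinomSeries hc hq z).eventually_ne one_ne_zero).exists
  induction n with
  | zero => simpa using hn
  | succ n ih =>
    refine ih fun h0 => hn ?_
    have hw := norm_pow_mul_lt_one hq hz n
    have h := qBinomSeries_functional_eq hc hq hw
    rw [h0, mul_zero, eq_comm, ← mul_assoc q, ← pow_succ'] at h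
    refine (mul_eq_zero.mp h).resolve_left (one_sub_ne_zero_of_norm_lt_one ?_)
    rw [norm_mul]
    exact (mul_le_of_le_one_left (norm_nonneg _) hc).trans_lt hw

/-! ### Tails of the continued fraction -/

lemma prod_range_two_mul {M : Type*} [CommMonoid M] (f : ℕ → M) (k : ℕ) :
    ∏ i ∈ Finset.range (2 * k), f i =
      (∏ i ∈ Finset.range k, f (2 * i)) * ∏ i ∈ Finset.range k, f (2 * i + 1) := by
  induction k with
  | zero => simp
  | succ k ih =>
    rw [Nat.mul_succ, Finset.prod_range_succ, Finset.prod_range_succ, ih, Finset.prod_range_succ,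
      Finset.prod_range_succ]
    simp only [mul_comm, mul_left_comm, mul_assoc]

lemma prod_one_sub_pow_ne_zero {q : ℂ} (hq : ‖q‖ < 1) {e : ℕ → ℕ} (he : ∀ i, e i ≠ 0) (k : ℕ) :
    ∏ i ∈ Finset.range k, (1 - q ^ e i) ≠ 0 :=
  Finset.prod_ne_zero_iff.mpr fun i _ => one_sub_pow_ne_zero hq (he i)

/-- The coefficient `(-q^n; q)_{2k} / ((q²; q²)_k (q; q²)_{n+k})` of the tails of the continued
fraction. -/
noncomputable def tailCoeff (q : ℂ) (n k : ℕ) : ℂ :=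
  (∏ i ∈ Finset.range (2 * k), (1 + q ^ (n + i))) /
    ((∏ i ∈ Finset.range k, (1 - q ^ (2 * i + 2))) *
      ∏ i ∈ Finset.range (n + k), (1 - q ^ (2 * i + 1)))

/-- A solution of the three-term recurrence of the continued fraction, converging to a nonzero
limit. -/
noncomputable def tail (a q : ℂ) (n : ℕ) : ℂ := ∑' k, tailCoeff q n k * a ^ (2 * k)

lemma norm_pow_le_pow_of_le {q : ℂ} (hq : ‖q‖ < 1) {m n : ℕ} (h : m ≤ n) :
    ‖q ^ n‖ ≤ ‖q‖ ^ m := by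
  rw [norm_pow]; exact pow_le_pow_of_le_one (norm_nonneg _) hq.le h

lemma exists_norm_tailCoeff_le {q : ℂ} (hq : ‖q‖ < 1) :
    ∃ C, ∀ n k, ‖tailCoeff q n k‖ ≤ C := by
  refine ⟨Real.exp (1 - ‖q‖)⁻¹ * (Real.exp ((1 - ‖q‖)⁻¹ * (1 - ‖q‖)⁻¹) *
    Real.exp ((1 - ‖q‖)⁻¹ * (1 - ‖q‖)⁻¹)), fun n k => ?_⟩
  have h0 := norm_nonneg q
  rw [tailCoeff, div_eq_mul_inv, norm_mul, mul_inv, norm_mul]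
  gcongr
  · exact norm_prod_one_add_le h0 hq (fun i => norm_pow_le_pow_of_le hq (by omega)) _
  · exact norm_prod_one_sub_inv_le h0 hq (fun i => norm_pow_le_pow_of_le hq (by omega)) _
  · exact norm_prod_one_sub_inv_le h0 hq (fun i => norm_pow_le_pow_of_le hq (by omega)) _

lemma summable_tail {a q : ℂ} (ha : ‖a‖ < 1) (hq : ‖q‖ < 1) (n : ℕ) :
    Summable fun k => tailCoeff q n k * a ^ (2 * k) := by
  obtain ⟨C, hC⟩ := exists_norm_tailCoeff_le hq
  exact summable_mul_pow (hC n) (fun k => by omega) ha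

lemma tailCoeff_zero {q : ℂ} (hq : ‖q‖ < 1) (n : ℕ) :
    tailCoeff q n 0 = (1 - q ^ (2 * n + 1)) * tailCoeff q (n + 1) 0 := by
  have h := one_sub_pow_ne_zero hq (2 * n).succ_ne_zero
  have h' := prod_one_sub_pow_ne_zero hq (e := fun i => 2 * i + 1) (fun i => by omega) n
  simp only [tailCoeff, mul_zero, Finset.prod_range_zero, add_zero, Finset.prod_range_succ, one_mul]
  field_simp

/-- Once common factors are removed, this is (1 + q^n)(1 - q^(2n+2k+3)) = (1 - q^(2n+1))(1 +
q^(n+2k+2)) + q^n (1 + q^(n+1))(1 - q^(2k+2)). -/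
lemma tailCoeff_succ {q : ℂ} (hq : ‖q‖ < 1) (n k : ℕ) :
    tailCoeff q n (k + 1) = (1 - q ^ (2 * n + 1)) * tailCoeff q (n + 1) (k + 1) +
      q ^ n * (1 + q ^ (n + 1)) ^ 2 * tailCoeff q (n + 2) k := by
  have e1 : ∏ i ∈ Finset.range (2 * (k + 1)), (1 + q ^ (n + i)) = (1 + q ^ n) *
      ((1 + q ^ (n + 1)) * ∏ i ∈ Finset.range (2 * k), (1 + q ^ (n + 2 + i))) := by
    rw [Nat.mul_succ, Finset.prod_range_succ', Finset.prod_range_succ', mul_comm, mul_comm _ (1 + _)]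
    congr! 5 with i
    ring
  have e2 : ∏ i ∈ Finset.range (2 * (k + 1)), (1 + q ^ (n + 1 + i)) =
      (1 + q ^ (n + 1)) * ((∏ i ∈ Finset.range (2 * k), (1 + q ^ (n + 2 + i))) *
        (1 + q ^ (n + 2 * k + 2))) := by
    rw [show 2 * (k + 1) = 2 * k + 1 + 1 by ring, Finset.prod_range_succ', Finset.prod_range_succ,
      mul_comm]
    simp only [show ∀ x, n + 1 + (x + 1) = n + 2 + x by intro x; ring, add_zero]
    ring
  have e3 : n + 1 + (k + 1) = n + (k + 1) + 1 := by ring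
  have e4 : n + 2 + k = n + (k + 1) + 1 := by ring
  have h1 := prod_one_sub_pow_ne_zero hq (e := fun i => 2 * i + 1) (fun i => by omega) (n + (k + 1))
  have h2 := prod_one_sub_pow_ne_zero hq (e := fun i => 2 * i + 2) (fun i => by omega) k
  have h3 := one_sub_pow_ne_zero hq (2 * (n + (k + 1))).succ_ne_zero
  have h4 := one_sub_pow_ne_zero hq (n := 2 * k + 2) (by omega)
  simp only [tailCoeff]
  rw [e1, e2, e3, e4, Finset.prod_range_succ (fun i => 1 - q ^ (2 * i + 2)),
    Finset.prod_range_succ (fun i => 1 - q ^ (2 * i + 1)) (n + (k + 1))]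
  generalize ∏ i ∈ Finset.range (2 * k), (1 + q ^ (n + 2 + i)) = W at *
  generalize ∏ i ∈ Finset.range (n + (k + 1)), (1 - q ^ (2 * i + 1)) = P at *
  generalize ∏ i ∈ Finset.range k, (1 - q ^ (2 * i + 2)) = R at *
  rw [Nat.succ_eq_add_one] at h3
  field_simp
  ring

lemma tail_recurrence {a q : ℂ} (ha : ‖a‖ < 1) (hq : ‖q‖ < 1) (n : ℕ) :
    tail a q n = (1 - q ^ (2 * n + 1)) * tail a q (n + 1) +
      a ^ 2 * q ^ n * (1 + q ^ (n + 1)) ^ 2 * tail a q (n + 2) := by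
  have h1 := (summable_tail ha hq (n + 1)).mul_left (1 - q ^ (2 * n + 1))
  have h2 := (summable_tail ha hq (n + 2)).mul_left (a ^ 2 * q ^ n * (1 + q ^ (n + 1)) ^ 2)
  unfold tail
  rw [← tsum_mul_left, ← tsum_mul_left, (summable_tail ha hq n).tsum_eq_zero_add,
    h1.tsum_eq_zero_add, add_assoc, ← ((summable_nat_add_iff 1).mpr h1).tsum_add h2]
  congr 1
  · rw [tailCoeff_zero hq]; ring
  · refine tsum_congr fun k => ?_
    rw [tailCoeff_succ hq]; ring

lemma qBinomCoeff_even (q : ℂ) (k : ℕ) : qBinomCoeff (-1) q (2 * k) = tailCoeff q 0 k := by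
  rw [qBinomCoeff, tailCoeff, prod_range_two_mul fun i => 1 - q ^ (i + 1), zero_add,
    mul_comm (∏ i ∈ Finset.range k, (1 - q ^ (2 * i + 1)))]
  simp [add_assoc]

/-- The 2 is the factor 1 + q^0 of (-1; q)_(2k+1); the rest is (-q; q)_(2k). -/
lemma qBinomCoeff_odd (q : ℂ) (k : ℕ) :
    qBinomCoeff (-1) q (2 * k + 1) = 2 * tailCoeff q 1 k := by
  rw [qBinomCoeff, tailCoeff, Finset.prod_range_succ', Finset.prod_range_succ,
    prod_range_two_mul fun i => 1 - q ^ (i + 1), add_comm 1 k, Finset.prod_range_succ]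
  simp only [add_assoc, add_comm 1, neg_mul, one_mul, sub_neg_eq_add, pow_zero, one_add_one_eq_two]
  rw [← mul_div_assoc, mul_comm (2 : ℂ), mul_comm (∏ i ∈ Finset.range k, (1 - q ^ (2 * i + 1))),
    mul_assoc (∏ i ∈ Finset.range k, (1 - q ^ (2 * i + 2)))]

lemma tail_zero_add_tail_one {a q : ℂ} (ha : ‖a‖ < 1) (hq : ‖q‖ < 1) :
    tail a q 0 + 2 * a * tail a q 1 = qBinomSeries (-1) q a := by
  have h1 := summable_qBinomSeries (c := -1) (by simp) hq ha
  have h0 : Summable fun k => qBinomCoeff (-1) q (2 * k) * a ^ (2 * k) :=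
    h1.comp_injective (i := fun k => 2 * k) fun x y h => by simpa using h
  have h2 : Summable fun k => qBinomCoeff (-1) q (2 * k + 1) * a ^ (2 * k + 1) :=
    h1.comp_injective (i := fun k => 2 * k + 1) fun x y h => by simpa using h
  have h3 := tsum_even_add_odd (f := fun k => qBinomCoeff (-1) q k * a ^ k) h0 h2
  rw [qBinomSeries, ← h3, tail, tail, ← tsum_mul_left]
  simp only [qBinomCoeff_even, qBinomCoeff_odd]
  congr 1
  exact tsum_congr fun k => by ring

lemma tail_neg (a q : ℂ) (n : ℕ) : tail (-a) q n = tail a q n := by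
  simp [tail, pow_mul]

lemma tail_zero_sub_tail_one {a q : ℂ} (ha : ‖a‖ < 1) (hq : ‖q‖ < 1) :
    tail a q 0 - 2 * a * tail a q 1 = qBinomSeries (-1) q (-a) := by
  rw [← tail_zero_add_tail_one (a := -a) (by simpa using ha) hq, tail_neg, tail_neg]
  ring

/-- By dominated convergence the coefficients may be replaced by their limits 1/((q²; q²)_k (q;
q²)_∞). What remains is a q-binomial series in base q² with c = 0, hence nonzero. -/
lemma tendsto_tail {a q : ℂ} (ha : ‖a‖ < 1) (hq : ‖q‖ < 1) :
    ∃ L : ℂ, L ≠ 0 ∧ Tendsto (tail a q) atTop (𝓝 L) := by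
  have hs : Summable fun i : ℕ => ‖-q ^ (2 * i + 1)‖ :=
    .of_nonneg_of_le (fun _ => norm_nonneg _)
      (fun i => by rw [norm_neg]; exact norm_pow_le_pow_of_le hq (by omega))
      (summable_geometric_of_lt_one (norm_nonneg q) hq)
  set P := ∏' i : ℕ, (1 + -q ^ (2 * i + 1))
  have hP0 : P ≠ 0 := tprod_one_add_ne_zero_of_summable
    (fun i => by rw [← sub_eq_add_neg]; exact one_sub_pow_ne_zero hq (2 * i).succ_ne_zero) hs
  have hPt : Tendsto (fun n => ∏ i ∈ Finset.range n, (1 - q ^ (2 * i + 1))) atTop (𝓝 P) := by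
    simpa only [sub_eq_add_neg] using (multipliable_one_add_of_summable hs).hasProd.tendsto_prod_nat
  have hq2 : ‖q ^ 2‖ < 1 := by rw [norm_pow]; exact pow_lt_one₀ (norm_nonneg _) hq two_ne_zero
  have ha2 : ‖a ^ 2‖ < 1 := by rw [norm_pow]; exact pow_lt_one₀ (norm_nonneg _) ha two_ne_zero
  refine ⟨qBinomSeries 0 (q ^ 2) (a ^ 2) / P,
    div_ne_zero (qBinomSeries_ne_zero (by simp) hq2 ha2) hP0, ?_⟩
  obtain ⟨C, hC⟩ := exists_norm_tailCoeff_le hq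
  rw [qBinomSeries, ← tsum_div_const]
  refine tendsto_tsum_of_dominated_convergence
    ((summable_geometric_of_lt_one (norm_nonneg a) ha).mul_left C) (fun k => ?_)
    (.of_forall fun n k => norm_mul_pow_le (hC n) (e := fun k => 2 * k) (fun k => by omega) le_rfl
      ha.le k)
  have h1 : Tendsto (fun n => ∏ i ∈ Finset.range (2 * k), (1 + q ^ (n + i))) atTop (𝓝 1) := by
    have := tendsto_finsetProd (f := fun i n => 1 + q ^ (n + i)) (Finset.range (2 * k))
      (a := fun _ => 1) (x := atTop) fun i _ => by
        simpa using ((tendsto_add_atTop_iff_nat i).mpr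
          (tendsto_pow_atTop_nhds_zero_of_norm_lt_one hq)).const_add 1
    simpa using this
  have h2 := (tendsto_add_atTop_iff_nat k).mpr hPt
  have hR := prod_one_sub_pow_ne_zero hq (e := fun i => 2 * i + 2) (fun i => by omega) k
  have h3 := (h1.div (h2.const_mul (∏ i ∈ Finset.range k, (1 - q ^ (2 * i + 2))))
    (mul_ne_zero hR hP0)).mul_const (a ^ (2 * k))
  convert h3 using 2
  · rfl
  simp only [qBinomCoeff, zero_mul, sub_zero, Finset.prod_const_one, ← pow_mul, mul_add, mul_one]
  field_simp

/-! ### Convergence of the continued fraction -/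

/-- The perturbed fixed-point iteration `W ↦ E - δ W` converges to `E` when `δ → 0`. -/
lemma tendsto_of_eq_sub_mul {W δ : ℕ → ℂ} {E : ℂ} (hδ : Tendsto δ atTop (𝓝 0))
    (hW : ∀ᶠ n in atTop, W (n + 1) = E - δ n * W n) : Tendsto W atTop (𝓝 E) := by
  obtain ⟨N, hN⟩ := eventually_atTop.mp (hW.and (hδ.norm.eventually_le_const
    (by norm_num : ‖(0 : ℂ)‖ < 1 / 2)))
  -- With ‖δ n‖ ≤ 1/2, the bound M = 2‖E‖ + ‖W N‖ is preserved because ‖E‖ + M/2 ≤ M.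
  have hb : ∀ n, ‖W (N + n)‖ ≤ 2 * ‖E‖ + ‖W N‖ := by
    intro n
    induction n with
    | zero => simp only [add_zero]; linarith [norm_nonneg E]
    | succ n ih =>
      obtain ⟨h1, h2⟩ := hN (N + n) (by omega)
      rw [← add_assoc, h1]
      have h3 := norm_sub_le E (δ (N + n) * W (N + n))
      rw [norm_mul] at h3
      nlinarith [norm_nonneg E, norm_nonneg (W N), norm_nonneg (W (N + n)), norm_nonneg (δ (N + n))]
  have hbdd : IsBoundedUnder (· ≤ ·) atTop ((‖·‖) ∘ W) :=
    ⟨2 * ‖E‖ + ‖W N‖, eventually_map.mpr (eventually_atTop.mpr ⟨N, fun n hn => by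
      obtain ⟨m, rfl⟩ := Nat.exists_eq_add_of_le hn
      exact hb m⟩)⟩
  have h0 : Tendsto (fun n => δ n * W n) atTop (𝓝 0) := hδ.zero_mul_isBoundedUnder_le hbdd
  refine (tendsto_add_atTop_iff_nat 1).mp ?_
  have h1 : Tendsto (fun n => E - δ n * W n) atTop (𝓝 E) := by simpa using h0.const_sub E
  exact h1.congr' (hW.mono fun n h => h.symm)

lemma cf_get?_zero (a q : ℂ) : (cf a q).s.get? 0 = some ⟨2 * a, 1 - q⟩ := by
  have : (cf a q).s.get? 0 = some ⟨2 * a, 1 - q ^ (2 * 0 + 1)⟩ := rfl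
  simpa using this

lemma cf_get?_succ (a q : ℂ) (n : ℕ) : (cf a q).s.get? (n + 1) =
    some ⟨a ^ 2 * q ^ n * (1 + q ^ (n + 1)) ^ 2, 1 - q ^ (2 * (n + 1) + 1)⟩ := rfl

/-- Convergence of `A n / B n` in the Riemann sphere, for `(A, B)` converging projectively. -/
lemma tendsto_convergent_of_ne_zero {g : GenContFract ℂ} {Y : ℕ → ℂ} {E O : ℂ}
    (hY : ∀ᶠ n in atTop, Y n ≠ 0) (hE : E ≠ 0)
    (hA : Tendsto (fun n => g.nums n * Y n) atTop (𝓝 O))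
    (hB : Tendsto (fun n => g.dens n * Y n) atTop (𝓝 E)) :
    Tendsto (convergent g) atTop (𝓝 ((O / E : ℂ) : OnePoint ℂ)) := by
  have h := (OnePoint.continuous_coe.tendsto (O / E)).comp (hA.div hB hE)
  refine h.congr' ?_
  filter_upwards [hY, hB.eventually_ne hE] with n h1 h2
  have h3 : g.dens n ≠ 0 := left_ne_zero_of_mul h2
  simp [convergent, h3, g.conv_eq_num_div_den, mul_div_mul_right _ _ h1]

lemma tendsto_convergent_infty {g : GenContFract ℂ} {Y : ℕ → ℂ} {O : ℂ}
    (hY : ∀ᶠ n in atTop, Y n ≠ 0) (hO : O ≠ 0)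
    (hA : Tendsto (fun n => g.nums n * Y n) atTop (𝓝 O))
    (hB : Tendsto (fun n => g.dens n * Y n) atTop (𝓝 0)) :
    Tendsto (convergent g) atTop (𝓝 OnePoint.infty) := by
  refine OnePoint.hasBasis_nhds_infty.tendsto_right_iff.mpr fun s hs => ?_
  obtain ⟨M, hM⟩ := hs.2.isBounded.exists_norm_le
  -- A convergent inside the compact set would give ‖A_n‖ ≤ M ‖B_n‖, making this difference
  -- nonpositive, yet its limit is positive.
  have h : Tendsto (fun n => ‖g.nums n * Y n‖ - M * ‖g.dens n * Y n‖) atTop (𝓝 ‖O‖) := by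
    simpa using hA.norm.sub (hB.norm.const_mul M)
  filter_upwards [hY, h.eventually_const_lt (norm_pos_iff.mpr hO)] with n h1 h2
  by_cases h3 : g.dens n = 0
  · simp [convergent, h3]
  refine Or.inl ⟨g.convs n, fun h4 => ?_, by simp [convergent, h3]⟩
  have h5 := hM _ h4
  rw [g.conv_eq_num_div_den, norm_div, div_le_iff₀ (norm_pos_iff.mpr h3)] at h5
  rw [norm_mul, norm_mul] at h2
  nlinarith [norm_nonneg (Y n)]

/-- X runs the recurrence forwards and the tail runs it backwards, so the bilinear pairing `hinv` is
constant in n. It reads W (n+1) = E - δ n * W n for W n = X n T_n, where δ n → 0 because of q^n and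
because T_n has a nonzero limit. -/
lemma tendsto_mul_tail {a q : ℂ} (ha : ‖a‖ < 1) (hq : ‖q‖ < 1) {X : ℕ → ℂ} {E : ℂ}
    (hX : ∀ n, X (n + 2) = (1 - q ^ (2 * (n + 1) + 1)) * X (n + 1) +
      a ^ 2 * q ^ n * (1 + q ^ (n + 1)) ^ 2 * X n)
    (hE : X 1 * tail a q 1 + a ^ 2 * (1 + q) ^ 2 * X 0 * tail a q 2 = E) :
    Tendsto (fun n => X n * tail a q n) atTop (𝓝 E) := by
  obtain ⟨L, hL, hT⟩ := tendsto_tail ha hq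
  have hinv : ∀ n, X (n + 1) * tail a q (n + 1) +
      a ^ 2 * q ^ n * (1 + q ^ (n + 1)) ^ 2 * X n * tail a q (n + 2) = E := by
    intro n
    induction n with
    | zero => simpa using hE
    | succ n ih =>
      rw [← ih, hX, tail_recurrence ha hq (n + 1)]
      ring
  have hqn := tendsto_pow_atTop_nhds_zero_of_norm_lt_one hq
  have hδ : Tendsto (fun n => a ^ 2 * q ^ n * (1 + q ^ (n + 1)) ^ 2 *
      (tail a q (n + 2) / tail a q n)) atTop (𝓝 0) := by
    have h := ((hqn.const_mul (a ^ 2)).mul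
      ((((tendsto_add_atTop_iff_nat 1).mpr hqn).const_add 1).pow 2)).mul
      (((tendsto_add_atTop_iff_nat 2).mpr hT).div hT hL)
    simpa using! h
  refine tendsto_of_eq_sub_mul hδ ?_
  filter_upwards [hT.eventually_ne hL] with n hn
  rw [← hinv n]
  field_simp
  ring

lemma tendsto_nums_mul_tail {a q : ℂ} (ha : ‖a‖ < 1) (hq : ‖q‖ < 1) :
    Tendsto (fun n => (cf a q).nums n * tail a q n) atTop (𝓝 (2 * a * tail a q 1)) := by
  refine tendsto_mul_tail ha hq
    (fun n => GenContFract.nums_recurrence (cf_get?_succ a q n) rfl rfl) ?_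
  rw [GenContFract.zeroth_num_eq_h, GenContFract.first_num_eq (cf_get?_zero a q)]
  simp [cf]

lemma tendsto_dens_mul_tail {a q : ℂ} (ha : ‖a‖ < 1) (hq : ‖q‖ < 1) :
    Tendsto (fun n => (cf a q).dens n * tail a q n) atTop (𝓝 (tail a q 0)) := by
  refine tendsto_mul_tail ha hq
    (fun n => GenContFract.dens_recurrence (cf_get?_succ a q n) rfl rfl) ?_
  rw [GenContFract.zeroth_den_eq_one, GenContFract.first_den_eq (cf_get?_zero a q),
    tail_recurrence ha hq 0]
  simp

lemma qBinomSeries_neg_one_ne_zero {q z : ℂ} (hq : ‖q‖ < 1) (hz : ‖z‖ < 1) :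
    qBinomSeries (-1) q z ≠ 0 :=
  qBinomSeries_ne_zero (by simp) hq hz

/-- The convergents have a limit in the Riemann sphere, which the Möbius map sends to a quotient
of `q`-binomial series. -/
lemma exists_tendsto_convergent {a q : ℂ} (ha : ‖a‖ < 1) (hq : ‖q‖ < 1) :
    ∃ w, Tendsto (convergent (cf a q)) atTop (𝓝 w) ∧ w ≠ ((1 : ℂ) : OnePoint ℂ) ∧
      moebius w = qBinomSeries (-1) q a / qBinomSeries (-1) q (-a) := by
  have hp := tail_zero_add_tail_one ha hq
  have hm := tail_zero_sub_tail_one ha hq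
  have hp0 := qBinomSeries_neg_one_ne_zero hq ha
  have hm0 := qBinomSeries_neg_one_ne_zero (z := -a) hq (by simpa using ha)
  have hA := tendsto_nums_mul_tail ha hq
  have hB := tendsto_dens_mul_tail ha hq
  obtain ⟨L, hL, hT⟩ := tendsto_tail ha hq
  rw [← hp] at hp0
  rw [← hm] at hm0
  rw [← hp, ← hm]
  -- If T_0 = 0, then 2a T_1 = F(a) ≠ 0 and the value is ∞. Otherwise the value 1 would force F(-a)
  -- = 0.
  by_cases hE : tail a q 0 = 0
  · rw [hE] at hB hp0 hm0 ⊢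
    rw [zero_add] at hp0
    refine ⟨_, tendsto_convergent_infty (hT.eventually_ne hL) hp0 hA hB,
      OnePoint.infty_ne_coe _, ?_⟩
    rw [zero_add, zero_sub, div_neg, div_self hp0]
    rfl
  · refine ⟨_, tendsto_convergent_of_ne_zero (hT.eventually_ne hL) hE hA hB, ?_, ?_⟩
    · rw [Ne, OnePoint.coe_eq_coe, div_eq_one_iff_eq hE]
      exact fun h => hm0 (sub_eq_zero.mpr h.symm)
    · have h1 : 1 - 2 * a * tail a q 1 / tail a q 0 =
          (tail a q 0 - 2 * a * tail a q 1) / tail a q 0 := by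
        field_simp
      change -1 + 2 / (1 - 2 * a * tail a q 1 / tail a q 0) = _
      rw [h1]
      field_simp
      ring

lemma tendsto_convergent_u {a q : ℂ} (ha : ‖a‖ < 1) (hq : ‖q‖ < 1) :
    Tendsto (convergent (cf a q)) atTop (𝓝 (u a q)) := by
  obtain ⟨w, hw, -⟩ := exists_tendsto_convergent ha hq
  exact tendsto_nhds_limUnder ⟨w, hw⟩

lemma u_ne_one {a q : ℂ} (ha : ‖a‖ < 1) (hq : ‖q‖ < 1) : u a q ≠ ((1 : ℂ) : OnePoint ℂ) := by
  obtain ⟨w, hw, h1, -⟩ := exists_tendsto_convergent ha hq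
  rwa [tendsto_nhds_unique (tendsto_convergent_u ha hq) hw]

lemma moebius_u {a q : ℂ} (ha : ‖a‖ < 1) (hq : ‖q‖ < 1) :
    moebius (u a q) = qBinomSeries (-1) q a / qBinomSeries (-1) q (-a) := by
  obtain ⟨w, hw, -, h2⟩ := exists_tendsto_convergent ha hq
  rwa [tendsto_nhds_unique (tendsto_convergent_u ha hq) hw]

/-! ### The Lambert-type series and its exponential -/

lemma term_eq (a q : ℂ) (n : ℕ) :
    term a q n = ((2 * (n : ℂ) + 1) * (1 - q ^ (2 * n + 1)))⁻¹ * a ^ (2 * n + 1) := by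
  rw [term, div_eq_inv_mul]

lemma norm_lambert_coeff_le {q : ℂ} (hq : ‖q‖ < 1) (n : ℕ) :
    ‖((2 * (n : ℂ) + 1) * (1 - q ^ (2 * n + 1)))⁻¹‖ ≤ (1 - ‖q‖)⁻¹ := by
  rw [norm_inv, norm_mul]
  have h1 : (1 : ℝ) ≤ ‖2 * (n : ℂ) + 1‖ := by
    have : 2 * (n : ℂ) + 1 = ((2 * n + 1 : ℕ) : ℂ) := by push_cast; ring
    rw [this, Complex.norm_natCast]
    exact_mod_cast Nat.le_add_left 1 (2 * n)
  have h2 : 1 - ‖q‖ ≤ ‖1 - q ^ (2 * n + 1)‖ := by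
    have h := norm_sub_norm_le (1 : ℂ) (q ^ (2 * n + 1))
    rw [norm_one, norm_pow] at h
    have h' := pow_le_of_le_one (norm_nonneg q) hq.le (2 * n).succ_ne_zero
    rw [Nat.succ_eq_add_one] at h'
    linarith
  refine inv_anti₀ (by linarith) (h2.trans ?_)
  exact le_mul_of_one_le_left (norm_nonneg _) h1

lemma summable_term {a q : ℂ} (ha : ‖a‖ < 1) (hq : ‖q‖ < 1) : Summable (term a q) :=
  (summable_mul_pow (norm_lambert_coeff_le hq) (e := fun n => 2 * n + 1) (fun n => by omega)
    ha).congr fun n => (term_eq a q n).symm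

lemma continuousOn_tsum_term {q : ℂ} (hq : ‖q‖ < 1) :
    ContinuousOn (fun a => ∑' n, term a q n) (Metric.ball 0 1) := by
  simp only [term_eq]
  exact continuousOn_tsum_mul_pow (norm_lambert_coeff_le hq) fun n => by omega

lemma tsum_term_zero (q : ℂ) : ∑' n, term 0 q n = 0 := by
  simp [term]

lemma hasSum_odd_pow_div {z : ℂ} (hz : ‖z‖ < 1) :
    HasSum (fun n : ℕ => 2 * (z ^ (2 * n + 1) / (2 * (n : ℂ) + 1)))
      (Complex.log (1 + z) - Complex.log (1 - z)) := by
  have h1 := Complex.hasSum_taylorSeries_neg_log hz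
  have h2 := Complex.hasSum_taylorSeries_neg_log (z := -z) (by simpa using hz)
  have h3 := h1.sub h2
  have hi : Function.Injective fun n : ℕ => 2 * n + 1 := fun x y h => by simpa using h
  rw [← hi.hasSum_iff] at h3
  · have e : Complex.log (1 + z) - Complex.log (1 - z) =
        -Complex.log (1 - z) - -Complex.log (1 - -z) := by
      rw [sub_neg_eq_add 1 z]; ring
    rw [e]
    refine h3.congr_fun fun n => ?_
    simp only [Function.comp_apply, (odd_two_mul_add_one n).neg_pow]
    push_cast
    ring
  · intro n hn
    have : Even n := by
      by_contra h
      obtain ⟨k, rfl⟩ := Nat.not_even_iff_odd.mp h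
      exact hn ⟨k, rfl⟩
    rw [this.neg_pow, sub_self]

/-- Subtracting the series at qa cancels 1 - q^(2n+1), leaving the odd logarithmic series. -/
lemma exp_tsum_term_functional_eq {a q : ℂ} (ha : ‖a‖ < 1) (hq : ‖q‖ < 1) :
    Complex.exp (4 * ∑' n, term a q n) =
      ((1 + a) / (1 - a)) ^ 2 * Complex.exp (4 * ∑' n, term (q * a) q n) := by
  have hqa := norm_mul_lt_one hq ha
  have h : 2 * (∑' n, term a q n - ∑' n, term (q * a) q n) =
      Complex.log (1 + a) - Complex.log (1 - a) := by
    rw [← (summable_term ha hq).tsum_sub (summable_term hqa hq), ← tsum_mul_left,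
      ← (hasSum_odd_pow_div ha).tsum_eq]
    refine tsum_congr fun n => ?_
    have h1 : (2 * (n : ℂ) + 1) ≠ 0 := by exact_mod_cast (2 * n).succ_ne_zero
    have h2 := one_sub_pow_ne_zero hq (2 * n).succ_ne_zero
    rw [Nat.succ_eq_add_one] at h2
    rw [term, term, mul_pow]
    field_simp
  have h' : 4 * ∑' n, term a q n =
      ((2 : ℕ) : ℂ) * (Complex.log (1 + a) - Complex.log (1 - a)) +
        4 * ∑' n, term (q * a) q n := by
    push_cast
    linear_combination 2 * h
  rw [h', Complex.exp_add, Complex.exp_nat_mul, Complex.exp_sub,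
    Complex.exp_log (one_add_ne_zero_of_norm_lt_one ha),
    Complex.exp_log (one_sub_ne_zero_of_norm_lt_one ha)]

lemma exp_tsum_term {a q : ℂ} (ha : ‖a‖ < 1) (hq : ‖q‖ < 1) :
    Complex.exp (4 * ∑' n, term a q n) =
      qBinomSeries (-1) q a / qBinomSeries (-1) q (-a) := by
  have hc : ‖(-1 : ℂ)‖ ≤ 1 := by simp
  -- Cross-multiplied form of the claim that exp(4∑) F(-·)/F(·) has the same value at a and at q^n
  -- a; letting n → ∞ makes that value 1.
  have hinv : ∀ n : ℕ, Complex.exp (4 * ∑' n, term a q n) * qBinomSeries (-1) q (-a) *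
      qBinomSeries (-1) q (q ^ n * a) = Complex.exp (4 * ∑' k, term (q ^ n * a) q k) *
        qBinomSeries (-1) q (q ^ n * -a) * qBinomSeries (-1) q a := by
    intro n
    induction n with
    | zero => simp
    | succ n ih =>
      have hw := norm_pow_mul_lt_one hq ha n
      have e1 := qBinomSeries_functional_eq hc hq hw
      have e2 := qBinomSeries_functional_eq (z := -(q ^ n * a)) hc hq (by simpa using hw)
      have e3 := exp_tsum_term_functional_eq hw hq
      have n1 := one_sub_ne_zero_of_norm_lt_one hw
      have n2 := one_add_ne_zero_of_norm_lt_one hw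
      have e4 : Complex.exp (4 * ∑' k, term (q ^ n * a) q k) * (1 - q ^ n * a) ^ 2 =
          (1 + q ^ n * a) ^ 2 * Complex.exp (4 * ∑' k, term (q * (q ^ n * a)) q k) := by
        rw [e3]; field_simp
      rw [mul_neg] at ih ⊢
      rw [mul_neg q] at e2
      rw [pow_succ', mul_assoc q]
      refine mul_left_cancel₀ (mul_ne_zero n1 n2) ?_
      generalize q ^ n * a = w at *
      linear_combination (-(1 - w) * Complex.exp (4 * ∑' n, term a q n) *
          qBinomSeries (-1) q (-a)) * e1 + (1 - w) ^ 2 * ih +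
        qBinomSeries (-1) q (-w) * qBinomSeries (-1) q a * e4 +
        (1 + w) * Complex.exp (4 * ∑' k, term (q * w) q k) * qBinomSeries (-1) q a * e2
  have hS : Tendsto (fun n : ℕ => Complex.exp (4 * ∑' k, term (q ^ n * a) q k)) atTop (𝓝 1) := by
    have h := (((continuousOn_tsum_term hq).continuousAt
      (Metric.ball_mem_nhds 0 one_pos)).tendsto.comp (tendsto_pow_mul_nhds_zero hq a)).const_mul 4
    rw [tsum_term_zero, mul_zero] at h
    rw [← Complex.exp_zero]
    exact (Complex.continuous_exp.tendsto 0).comp h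
  have h1 := (tendsto_qBinomSeries hc hq a).const_mul
    (Complex.exp (4 * ∑' n, term a q n) * qBinomSeries (-1) q (-a))
  have h2 := (hS.mul (tendsto_qBinomSeries hc hq (-a))).mul_const (qBinomSeries (-1) q a)
  simp only [hinv] at h1
  have h := tendsto_nhds_unique h1 h2
  rw [eq_div_iff (qBinomSeries_ne_zero hc hq (by simpa using ha))]
  simpa using h

lemma exp_tsum_term_eq_moebius {a q : ℂ} (ha : ‖a‖ < 1) (hq : ‖q‖ < 1) :
    Complex.exp (4 * ∑' n, term a q n) = moebius (u a q) := by
  rw [exp_tsum_term ha hq, moebius_u ha hq]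

lemma isLogBranch_tsum_term {q : ℂ} (hq : ‖q‖ < 1) :
    IsLogBranch (fun a => 4 * ∑' n, term a q n) (fun a => moebius (u a q)) :=
  ⟨continuousOn_const.mul (continuousOn_tsum_term hq), by simp [tsum_term_zero],
    fun _ ha => exp_tsum_term_eq_moebius (mem_ball_zero_iff.mp ha) hq⟩

/-! ### Uniqueness of the branch, and real parameters -/

/-- Two lifts through the covering map exp that agree at 0 agree on the connected disc. -/
lemma IsLogBranch.eqOn {ℓ₁ ℓ₂ F : ℂ → ℂ} (h₁ : IsLogBranch ℓ₁ F) (h₂ : IsLogBranch ℓ₂ F) :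
    Set.EqOn ℓ₁ ℓ₂ (Metric.ball 0 1) :=
  Complex.isCoveringMap_exp.eqOn_of_comp_eqOn (convex_ball 0 1).isPreconnected h₁.1 h₂.1
    (fun a ha => Subtype.ext ((h₁.2.2 a ha).trans (h₂.2.2 a ha).symm))
    (Metric.mem_ball_self one_pos) (h₁.2.1.trans h₂.2.1.symm)

/-- Positivity of T excludes ∞, which maps to -1; elsewhere the Möbius map is inverted. -/
lemma eq_coe_of_moebius_eq_ofReal {w : OnePoint ℂ} {T : ℝ} (hT : 0 < T)
    (hw : w ≠ ((1 : ℂ) : OnePoint ℂ)) (h : moebius w = T) :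
    w = ((((T - 1) / (T + 1) : ℝ) : ℂ) : OnePoint ℂ) := by
  induction w using OnePoint.rec with
  | infty =>
    have h' : (-1 : ℂ) = T := h
    have : -1 = T := by exact_mod_cast h'
    linarith
  | coe z =>
    have h' : -1 + 2 / (1 - z) = (T : ℂ) := h
    have hz : 1 - z ≠ 0 := fun h0 => hw (by rw [← sub_eq_zero.mp h0])
    have hT1 : (T : ℂ) + 1 ≠ 0 := by exact_mod_cast (by linarith : T + 1 ≠ 0)
    rw [OnePoint.coe_eq_coe]
    push_cast
    rw [eq_div_iff hT1, ← h']
    field_simp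
    ring

lemma exists_real_u {a q : ℝ} (ha : |a| < 1) (hq : |q| < 1) :
    ∃ x : ℝ, u (a : ℂ) (q : ℂ) = ((x : ℂ) : OnePoint ℂ) ∧ |x| < 1 ∧
      4 * ∑' n : ℕ, a ^ (2 * n + 1) / ((2 * (n : ℝ) + 1) * (1 - q ^ (2 * n + 1))) =
        Real.log (-1 + 2 / (1 - x)) := by
  have ha' : ‖(a : ℂ)‖ < 1 := by simpa using ha
  have hq' : ‖(q : ℂ)‖ < 1 := by simpa using hq
  set S : ℝ := 4 * ∑' n : ℕ, a ^ (2 * n + 1) / ((2 * (n : ℝ) + 1) * (1 - q ^ (2 * n + 1))) with hS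
  have hSc : 4 * ∑' n, term a q n = (S : ℂ) := by
    rw [hS]
    push_cast
    rfl
  have hT := Real.exp_pos S
  have hm := exp_tsum_term_eq_moebius ha' hq'
  rw [hSc, ← Complex.ofReal_exp] at hm
  refine ⟨_, eq_coe_of_moebius_eq_ofReal hT (u_ne_one ha' hq') hm.symm, ?_, ?_⟩
  · rw [abs_lt, lt_div_iff₀ (by linarith), div_lt_one (by linarith)]
    constructor <;> linarith
  · have e : -1 + 2 / (1 - (Real.exp S - 1) / (Real.exp S + 1)) = Real.exp S := by
      have h1 : Real.exp S + 1 ≠ 0 := by linarith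
      have h2 : 1 - (Real.exp S - 1) / (Real.exp S + 1) = 2 / (Real.exp S + 1) := by
        field_simp
        ring
      rw [h2]
      field_simp
      ring
    rw [e, Real.log_exp]

end RamanujanCF

theorem proposition7 :
    -- convergence of both sides; the quotient `2 / (1 - u(a, q))` is meaningful
    (∀ a q : ℂ, ‖a‖ < 1 → ‖q‖ < 1 →
      Summable (RamanujanCF.term a q) ∧
      Tendsto (RamanujanCF.convergent (RamanujanCF.cf a q)) atTop (𝓝 (RamanujanCF.u a q)) ∧
      RamanujanCF.u a q ≠ ((1 : ℂ) : OnePoint ℂ)) ∧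
    -- the series is the branch of the logarithm on the unit disc that vanishes at `a = 0`
    (∀ q : ℂ, ‖q‖ < 1 →
      RamanujanCF.IsLogBranch (fun a => 4 * ∑' n : ℕ, RamanujanCF.term a q n)
        (fun a => RamanujanCF.moebius (RamanujanCF.u a q)) ∧
      ∀ ℓ : ℂ → ℂ,
        RamanujanCF.IsLogBranch ℓ (fun a => RamanujanCF.moebius (RamanujanCF.u a q)) →
        ∀ a : ℂ, ‖a‖ < 1 → 4 * ∑' n : ℕ, RamanujanCF.term a q n = ℓ a) ∧
    -- it is the principal value whenever its imaginary part allows this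
    (∀ a q : ℂ, ‖a‖ < 1 → ‖q‖ < 1 →
      (4 * ∑' n : ℕ, RamanujanCF.term a q n).im ∈ Set.Ioc (-Real.pi) Real.pi →
      4 * ∑' n : ℕ, RamanujanCF.term a q n =
        Complex.log (RamanujanCF.moebius (RamanujanCF.u a q))) ∧
    -- for real parameters it is the real logarithm
    (∀ a q : ℝ, |a| < 1 → |q| < 1 →
      ∃ x : ℝ, RamanujanCF.u (a : ℂ) (q : ℂ) = (((x : ℝ) : ℂ) : OnePoint ℂ) ∧ |x| < 1 ∧
        4 * ∑' n : ℕ, a ^ (2 * n + 1) / ((2 * (n : ℝ) + 1) * (1 - q ^ (2 * n + 1))) =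
          Real.log (-1 + 2 / (1 - x))) := by
  open RamanujanCF in
  refine ⟨fun a q ha hq => ⟨summable_term ha hq, tendsto_convergent_u ha hq, u_ne_one ha hq⟩,
    fun q hq => ⟨isLogBranch_tsum_term hq, fun ℓ hℓ a ha =>
      (isLogBranch_tsum_term hq).eqOn hℓ (mem_ball_zero_iff.mpr ha)⟩,
    fun a q ha hq him => ?_, fun a q ha hq => exists_real_u ha hq⟩
  rw [← exp_tsum_term_eq_moebius ha hq, Complex.log_exp him.1 him.2]
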